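/- Consider continuous logic in the language of bi-invariant metric groups: the symbols are multiplication, inverse, the identity and a metric $d$ with values in $[0,1]$. Structures are groups with a metric of diameter at most $1$ that is invariant under left and right translations. Atomic formulas are $d(s,t)$ for group terms $s,t$. The connectives are all continuous functions $[0,1]^k\to[0,1]$, and the quantifiers are $\sup$ and $\inf$. For a sentence $\varphi$ and a structure $G$, let $\varphi^G\in[0,1]$ be the value of $\varphi$ in $G$. In this statement a $\Sigma_2$ sentence is a sentence $\inf_x\sup_{y_1,\dots,y_n}\psi(y_1,\dots,y_n,x)$ with $\psi$ quantifier-free, $x$ a single variable and $n\ge 0$. A $\Pi_2$ sentence is a sentence $\sup_x\inf_{y_1,\dots,y_n}\psi(y_1,\dots,y_n,x)$ with $\psi$, $x$ and $n$ as before. The symmetric group $S_n$ carries the normalized Hamming distance $d(\sigma,\tau)=\frac1n|\{i:\sigma(i)\ne\tau(i)\}|$. **Theorem.** (1) For every $\Sigma_2$ sentence $\varphi$, the sequence $(\varphi^{S_n})_n$ converges. (2) Consequently, all universal sofic groups have the same metric $\Sigma_2$ theory and the same metric $\Pi_2$ theory. That is, for nonprincipal ultrafilters $\mathcal U,\mathcal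 V$ on $\mathbb N$, let $G_{\mathcal U}$ and $G_{\mathcal V}$ be the metric ultraproducts of the sequence $(S_n)_n$. Here $G_{\mathcal U}$ is the quotient of $\prod_n S_n$ by the normal subgroup $\{(\sigma_n):\lim_{n\to\mathcal U}d(\sigma_n,e)=0\}$, with the metric $d([\sigma],[\tau])=\lim_{n\to\mathcal U}d(\sigma_n,\tau_n)$. Then $\varphi^{G_{\mathcal U}}=\varphi^{G_{\mathcal V}}$ for every $\Sigma_2$ sentence $\varphi$ and for every $\Pi_2$ sentence $\varphi$. -/

import Mathlib

open Filter Topology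

noncomputable section

/-! ### Bi-invariant metric groups -/

/-- A group with a metric of diameter at most `1` that is invariant under all left and all right
translations: a structure for the language of bi-invariant metric groups. -/
class IsBiinvariantMetricGroup (G : Type*) [Group G] [MetricSpace G] : Prop where
  dist_mul_left' : ∀ a b c : G, dist (a * b) (a * c) = dist b c
  dist_mul_right' : ∀ a b c : G, dist (b * a) (c * a) = dist b c
  dist_le_one' : ∀ a b : G, dist a b ≤ 1

/-! ### Continuous logic in the language of bi-invariant metric groups

The symbols are the multiplication, the inverse, the identity and the metric. -/

/-- Terms in the variables `x_0, …, x_{n-1}`. -/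
inductive GroupTerm (n : ℕ) : Type
  | var (i : Fin n) : GroupTerm n
  | one : GroupTerm n
  | mul (s t : GroupTerm n) : GroupTerm n
  | inv (t : GroupTerm n) : GroupTerm n

/-- The interpretation of a term at an assignment of the variables. -/
def GroupTerm.eval {G : Type*} [Group G] {n : ℕ} (v : Fin n → G) : GroupTerm n → G
  | .var i => v i
  | .one => 1
  | .mul s t => s.eval v * t.eval v
  | .inv t => (t.eval v)⁻¹

/-- Formulas with free variables among `x_0, …, x_{n-1}`. The atomic formulas are the distances
`d(s, t)`, the connectives of arity `k` are all continuous functions `[0,1]^k → [0,1]`, and the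
quantifiers are `sup` and `inf`, which bind the last variable `x_n` of a formula in `n + 1`
variables. -/
inductive MetricFormula : ℕ → Type
  | dist {n : ℕ} (s t : GroupTerm n) : MetricFormula n
  | conn {n k : ℕ} (u : C(Fin k → unitInterval, unitInterval))
      (φ : Fin k → MetricFormula n) : MetricFormula n
  | sup {n : ℕ} (φ : MetricFormula (n + 1)) : MetricFormula n
  | inf {n : ℕ} (φ : MetricFormula (n + 1)) : MetricFormula n

namespace MetricFormula

/-- The interpretation `φ^G(v) ∈ [0,1]` of a formula at an assignment `v` of its variables. -/
def eval {G : Type*} [Group G] [MetricSpace G] [IsBiinvariantMetricGroup G] :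
    {n : ℕ} → MetricFormula n → (Fin n → G) → unitInterval
  | _, .dist s t, v => ⟨Dist.dist (s.eval v) (t.eval v), dist_nonneg,
      IsBiinvariantMetricGroup.dist_le_one' _ _⟩
  | _, .conn u φ, v => u fun i => (φ i).eval v
  | n, .sup φ, v => ⨆ a : G, φ.eval (Fin.snoc v a : Fin (n + 1) → G)
  | n, .inf φ, v => ⨅ a : G, φ.eval (Fin.snoc v a : Fin (n + 1) → G)

/-- The value `φ^G ∈ [0,1]` of a sentence. -/
def value (φ : MetricFormula 0) (G : Type*) [Group G] [MetricSpace G]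
    [IsBiinvariantMetricGroup G] : unitInterval :=
  φ.eval (Fin.elim0 : Fin 0 → G)

/-- A formula without quantifiers. -/
def IsQuantifierFree : {n : ℕ} → MetricFormula n → Prop
  | _, .dist _ _ => True
  | _, .conn _ φ => ∀ i, (φ i).IsQuantifierFree
  | _, .sup _ => False
  | _, .inf _ => False

/-- `sup_{y_1} ⋯ sup_{y_n} φ`, quantifying the last `n` variables. -/
def sups {k : ℕ} : (n : ℕ) → MetricFormula (k + n) → MetricFormula k
  | 0, φ => φ
  | n + 1, φ => sups n (.sup φ)

/-- `inf_{y_1} ⋯ inf_{y_n} φ`, quantifying the last `n` variables. -/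
def infs {k : ℕ} : (n : ℕ) → MetricFormula (k + n) → MetricFormula k
  | 0, φ => φ
  | n + 1, φ => infs n (.inf φ)

/-- Sentences `inf_x sup_{y_1, …, y_n} ψ(x, y_1, …, y_n)` with `ψ` quantifier-free. -/
def IsSigmaTwo (φ : MetricFormula 0) : Prop :=
  ∃ (n : ℕ) (ψ : MetricFormula (0 + 1 + n)), ψ.IsQuantifierFree ∧ φ = .inf (sups n ψ)

/-- Sentences `sup_x inf_{y_1, …, y_n} ψ(x, y_1, …, y_n)` with `ψ` quantifier-free. -/
def IsPiTwo (φ : MetricFormula 0) : Prop :=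
  ∃ (n : ℕ) (ψ : MetricFormula (0 + 1 + n)), ψ.IsQuantifierFree ∧ φ = .sup (infs n ψ)

end MetricFormula

/-! ### Symmetric groups -/

/-- The normalized Hamming distance on the symmetric group `S_n`. -/
instance permFinMetricSpace (n : ℕ) : MetricSpace (Equiv.Perm (Fin n)) where
  dist σ τ := (hammingDist (σ : Fin n → Fin n) τ : ℝ) / n
  dist_self σ := by simp
  dist_comm σ τ := by simp [hammingDist_comm]
  dist_triangle σ τ ρ := by
    rw [← add_div]
    gcongr
    exact_mod_cast hammingDist_triangle _ _ _
  eq_of_dist_eq_zero := by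
    intro σ τ h
    rcases Nat.eq_zero_or_pos n with rfl | hn
    · exact Subsingleton.elim _ _
    · rw [div_eq_zero_iff] at h
      rcases h with h | h
      · exact DFunLike.coe_injective (hammingDist_eq_zero.1 (by exact_mod_cast h))
      · exact absurd h (by positivity)

theorem permFin_dist (n : ℕ) (σ τ : Equiv.Perm (Fin n)) :
    dist σ τ = ((Finset.univ.filter fun i => σ i ≠ τ i).card : ℝ) / n := rfl

instance permFinIsBiinvariant (n : ℕ) : IsBiinvariantMetricGroup (Equiv.Perm (Fin n)) where
  dist_mul_left' a b c := by simp [permFin_dist]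
  dist_mul_right' a b c := by
    rw [permFin_dist, permFin_dist]
    congr 2
    exact Finset.card_equiv a fun i => by
      rw [Finset.mem_filter, Finset.mem_filter]
      simp
  dist_le_one' a b := by
    rw [permFin_dist]
    apply div_le_one_of_le₀ _ (by positivity)
    exact_mod_cast (Finset.card_le_univ _).trans_eq (Fintype.card_fin n)

/-! ### Metric ultraproducts -/

section Ultraproduct

variable {ι : Type*} (U : Ultrafilter ι) (G : ι → Type*) [∀ i, Group (G i)]
  [∀ i, MetricSpace (G i)] [∀ i, IsBiinvariantMetricGroup (G i)]

/-- The product of the groups `G i`, to be endowed with the pseudometric given by `U`. -/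
def PreUltraproduct (_U : Ultrafilter ι) (G : ι → Type*) : Type _ := ∀ i, G i

instance PreUltraproduct.instGroup : Group (PreUltraproduct U G) :=
  inferInstanceAs (Group (∀ i, G i))

variable {G}

/-- The limit `lim_{i → U} d(f_i, g_i)`. -/
def ultraDist (f g : ∀ i, G i) : ℝ := limUnder (U : Filter ι) fun i => dist (f i) (g i)

theorem tendsto_ultraDist (f g : ∀ i, G i) :
    Tendsto (fun i => dist (f i) (g i)) U (𝓝 (ultraDist U f g)) := by
  obtain ⟨x, -, hx⟩ := (isCompact_Icc (a := (0 : ℝ)) (b := 1)).ultrafilter_le_nhds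
    (U.map fun i => dist (f i) (g i)) (by
      rw [le_principal_iff]
      exact Filter.mem_map.2 (Filter.univ_mem' fun i =>
        ⟨dist_nonneg, IsBiinvariantMetricGroup.dist_le_one' _ _⟩))
  exact tendsto_nhds_limUnder ⟨x, hx⟩

variable (G)

/-- The pseudometric `d(f, g) = lim_{i → U} d(f_i, g_i)`. -/
instance PreUltraproduct.instPseudoMetricSpace : PseudoMetricSpace (PreUltraproduct U G) where
  dist f g := ultraDist U f g
  dist_self f := tendsto_nhds_unique (tendsto_ultraDist U f f) (by simp)
  dist_comm f g := tendsto_nhds_unique (tendsto_ultraDist U f g) (by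
    simpa only [dist_comm] using tendsto_ultraDist U g f)
  dist_triangle f g h := le_of_tendsto_of_tendsto' (tendsto_ultraDist U f h)
    ((tendsto_ultraDist U f g).add (tendsto_ultraDist U g h)) fun _ => dist_triangle _ _ _

theorem PreUltraproduct.dist_mul_left (a b c : PreUltraproduct U G) :
    dist (a * b) (a * c) = dist b c :=
  tendsto_nhds_unique (tendsto_ultraDist U (a * b) (a * c)) (by
    refine (tendsto_ultraDist U b c).congr fun i => ?_
    exact (IsBiinvariantMetricGroup.dist_mul_left' (a i) (b i) (c i)).symm)

theorem PreUltraproduct.dist_mul_right (a b c : PreUltraproduct U G) :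
    dist (b * a) (c * a) = dist b c :=
  tendsto_nhds_unique (tendsto_ultraDist U (b * a) (c * a)) (by
    refine (tendsto_ultraDist U b c).congr fun i => ?_
    exact (IsBiinvariantMetricGroup.dist_mul_right' (a i) (b i) (c i)).symm)

theorem PreUltraproduct.dist_inv (a b : PreUltraproduct U G) :
    dist a⁻¹ b⁻¹ = dist a b := by
  rw [← PreUltraproduct.dist_mul_left U G a, ← PreUltraproduct.dist_mul_right U G b]
  simp [dist_comm]

instance PreUltraproduct.instIsTopologicalGroup : IsTopologicalGroup (PreUltraproduct U G) where
  continuous_mul := by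
    refine (LipschitzWith.of_dist_le_mul (K := 2) fun p q => ?_).continuous
    calc dist (p.1 * p.2) (q.1 * q.2)
        ≤ dist (p.1 * p.2) (q.1 * p.2) + dist (q.1 * p.2) (q.1 * q.2) := dist_triangle _ _ _
      _ = dist p.1 q.1 + dist p.2 q.2 := by
        rw [PreUltraproduct.dist_mul_left, PreUltraproduct.dist_mul_right]
      _ ≤ dist p q + dist p q := add_le_add (le_max_left _ _) (le_max_right _ _)
      _ = (2 : NNReal) * dist p q := by push_cast; ring
  continuous_inv := (Isometry.of_dist_eq fun a b => PreUltraproduct.dist_inv U G a b).continuous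

/-- The metric ultraproduct: the quotient of the product of the groups `G i` by the normal
subgroup of the `f` with `lim_{i → U} d(f_i, 1) = 0`, that is, by the relation
`lim_{i → U} d(f_i, g_i) = 0`, with the induced group operations and the induced metric. -/
abbrev MetricUltraproduct : Type _ := SeparationQuotient (PreUltraproduct U G)

instance MetricUltraproduct.instIsBiinvariant :
    IsBiinvariantMetricGroup (MetricUltraproduct U G) where
  dist_mul_left' a b c := by
    obtain ⟨a, rfl⟩ := SeparationQuotient.surjective_mk a
    obtain ⟨b, rfl⟩ := SeparationQuotient.surjective_mk b
    obtain ⟨c, rfl⟩ := SeparationQuotient.surjective_mk c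
    simp only [← SeparationQuotient.mk_mul, SeparationQuotient.dist_mk,
      PreUltraproduct.dist_mul_left]
  dist_mul_right' a b c := by
    obtain ⟨a, rfl⟩ := SeparationQuotient.surjective_mk a
    obtain ⟨b, rfl⟩ := SeparationQuotient.surjective_mk b
    obtain ⟨c, rfl⟩ := SeparationQuotient.surjective_mk c
    simp only [← SeparationQuotient.mk_mul, SeparationQuotient.dist_mk,
      PreUltraproduct.dist_mul_right]
  dist_le_one' a b := by
    obtain ⟨a, rfl⟩ := SeparationQuotient.surjective_mk a
    obtain ⟨b, rfl⟩ := SeparationQuotient.surjective_mk b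
    rw [SeparationQuotient.dist_mk]
    exact le_of_tendsto' (tendsto_ultraDist U a b)
      fun _ => IsBiinvariantMetricGroup.dist_le_one' _ _

end Ultraproduct

/-- The universal sofic group given by an ultrafilter `U` on `ℕ`: the metric ultraproduct of the
symmetric groups. -/
abbrev UniversalSoficGroup (U : Ultrafilter ℕ) : Type :=
  MetricUltraproduct U fun n => Equiv.Perm (Fin n)

end

/-! The values `φ^{S_n}` of a `Σ₂` sentence are almost increasing: up to `ε`, the value at a large
`n` is at most the value at every `N` that is large compared with `n`. A bounded sequence with this
property converges.

To compare `S_n` with `S_N`, take a candidate `σ ∈ S_N` for the outer infimum. It suffices to find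
`τ ∈ S_n` and an almost isometric homomorphism `f : S_n → S_N` with `f τ` close to `σ`
(`exists_hom_dist_le`). Indeed `f` carries every tuple `y` of `S_n` to one of `S_N` with nearly the
same value of `ψ`, so the supremum at `τ` is at most the supremum at `σ` plus `ε` (`eval_sups_le`).

The pair `(τ, f)` exists because a single permutation is determined up to conjugacy by its cycle
type; this is where having only one variable `x` matters. A small change of `σ` makes all cycles
short. Dividing the multiplicity of each cycle length by `q = N / n` then presents `σ`, up to few
points, as `q` disjoint copies of some `τ`. Repeating `q` times and conjugating gives `f`, which
scales distances by `qn/N`, a factor close to `1`.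

For the ultraproducts, Łoś's theorem gives the value as a limit along the ultrafilter, which is the
ordinary limit; `Π₂` sentences follow by the connective `1 - x`. -/

noncomputable section

section Biinvariant

variable {G : Type*} [Group G] [MetricSpace G] [IsBiinvariantMetricGroup G]

theorem IsBiinvariantMetricGroup.dist_mul_mul_le' (a b c d : G) :
    dist (a * b) (c * d) ≤ dist a c + dist b d := by
  calc dist (a * b) (c * d) ≤ dist (a * b) (c * b) + dist (c * b) (c * d) := dist_triangle _ _ _
    _ = dist a c + dist b d := by rw [dist_mul_right', dist_mul_left']

theorem IsBiinvariantMetricGroup.dist_inv_inv' (a b : G) : dist a⁻¹ b⁻¹ = dist a b := by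
  rw [← dist_mul_left' a, ← dist_mul_right' b]
  simp [dist_comm]

end Biinvariant

open IsBiinvariantMetricGroup

/-! ### Hamming distance and cycle types. -/

namespace Equiv.Perm

/-- Since `cycleType` omits fixed points, its sum counts the moved points. Distances thus depend on
cycle types only, so a homomorphism multiplying cycle types by `q` rescales them. -/
theorem dist_eq_sum_cycleType {n : ℕ} (σ τ : Perm (Fin n)) :
    dist σ τ = ((τ⁻¹ * σ).cycleType.sum : ℝ) / n := by
  rw [sum_cycleType, permFin_dist]
  congr 3
  ext i
  simp [mem_support, Equiv.symm_apply_eq]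

theorem dist_one_eq_sum_cycleType {n : ℕ} (σ : Perm (Fin n)) :
    dist σ 1 = (σ.cycleType.sum : ℝ) / n := by
  rw [dist_eq_sum_cycleType, inv_one, one_mul]

theorem dist_one_eq_card_support {n : ℕ} (σ : Perm (Fin n)) :
    dist σ 1 = (σ.support.card : ℝ) / n := by
  rw [dist_one_eq_sum_cycleType, sum_cycleType]

theorem dist_swap_one_le {n : ℕ} (a b : Fin n) : dist (swap a b) 1 ≤ 2 / n := by
  rw [dist_one_eq_card_support]
  gcongr
  by_cases h : a = b
  · simp [h]
  · rw [card_support_swap h]; norm_num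

/-! ### Cutting the cycles of a permutation into short cycles -/

theorem formPerm_append_cons {α : Type*} [DecidableEq α] (l : List α) (a b : α) (s : List α) :
    (l ++ a :: b :: s).formPerm = (l ++ [a]).formPerm * swap a b * (b :: s).formPerm := by
  induction l with
  | nil => simp
  | cons c l ih =>
    cases l with
    | nil => simp [mul_assoc]
    | cons d l =>
      simp only [List.cons_append, List.formPerm_cons_cons] at ih ⊢
      rw [ih]
      simp only [mul_assoc]

theorem exists_formPerm_append {α : Type*} [DecidableEq α] {l s : List α} (hl : l ≠ [])
    (hs : s ≠ []) : ∃ a b, (l ++ s).formPerm = l.formPerm * swap a b * s.formPerm := by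
  obtain ⟨l, a, rfl⟩ := List.eq_nil_or_concat l |>.resolve_left hl
  obtain ⟨b, s, rfl⟩ := List.exists_cons_of_ne_nil hs
  exact ⟨a, b, by simpa using formPerm_append_cons l a b s⟩

/-- Cut off blocks of length `L`. Each cut removes one transposition, at cost at most `2 / N`, and
uses up `L` points. The control on the support keeps the pieces disjoint, so that their cycle types
add. -/
theorem exists_dist_formPerm_le {N L : ℕ} (hL : 0 < L) (l : List (Fin N)) (hl : l.Nodup) :
    ∃ τ : Perm (Fin N), τ.support ⊆ l.toFinset ∧ (∀ i ∈ τ.cycleType, i ≤ L) ∧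
      dist l.formPerm τ * L ≤ 2 * l.length / N := by
  induction hm : l.length using Nat.strong_induction_on generalizing l with
  | _ m ih =>
  subst hm
  by_cases hlen : l.length ≤ L
  · refine ⟨l.formPerm, List.support_formPerm_le l, ?_, by simp; positivity⟩
    intro i hi
    have h1 := le_card_support_of_mem_cycleType hi
    have h2 := Finset.card_le_card (List.support_formPerm_le l)
    have h3 := l.toFinset_card_le
    omega
  · push Not at hlen
    have hlsplit := List.take_append_drop L l
    have hnd : (l.take L ++ l.drop L).Nodup := by rwa [hlsplit]
    obtain ⟨τ, hτs, hτc, hτd⟩ := ih (l.drop L).length (by simp; omega) (l.drop L)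
      hnd.of_append_right rfl
    have hdisj : Disjoint (l.take L).formPerm τ := by
      rw [disjoint_iff_disjoint_support]
      refine Finset.disjoint_of_subset_left (List.support_formPerm_le _)
        (Finset.disjoint_of_subset_right hτs ?_)
      rw [Finset.disjoint_left]
      intro a ha hb
      exact (List.disjoint_of_nodup_append hnd) (List.mem_toFinset.1 ha) (List.mem_toFinset.1 hb)
    refine ⟨(l.take L).formPerm * τ, ?_, ?_, ?_⟩
    · refine (support_mul_le _ _).trans (Finset.union_subset ?_ ?_)
      · exact (List.support_formPerm_le _).trans fun a ha => by
          rw [List.mem_toFinset] at ha ⊢; exact List.mem_of_mem_take ha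
      · exact hτs.trans fun a ha => by
          rw [List.mem_toFinset] at ha ⊢; exact List.mem_of_mem_drop ha
    · intro i hi
      rw [hdisj.cycleType_mul, Multiset.mem_add] at hi
      rcases hi with hi | hi
      · have h1 := le_card_support_of_mem_cycleType hi
        have h2 := Finset.card_le_card (List.support_formPerm_le (l.take L))
        have h3 := (l.take L).toFinset_card_le
        have h4 := List.length_take_le L l
        omega
      · exact hτc i hi
    · obtain ⟨a, b, hab⟩ := exists_formPerm_append (l := l.take L) (s := l.drop L)
        (by rw [← List.length_pos_iff]; simp; omega) (by rw [← List.length_pos_iff]; simp; omega)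
      rw [hlsplit] at hab
      have h1 : dist l.formPerm ((l.take L).formPerm * τ) ≤ 2 / N + dist (l.drop L).formPerm τ := by
        rw [hab]
        refine (dist_mul_mul_le' _ _ _ _).trans (add_le_add_left ?_ _)
        calc dist ((l.take L).formPerm * swap a b) (l.take L).formPerm
            = dist ((l.take L).formPerm * swap a b) ((l.take L).formPerm * 1) := by rw [mul_one]
          _ = dist (swap a b) 1 := dist_mul_left' _ _ _
          _ ≤ 2 / N := dist_swap_one_le a b
      have h2 : (l.length : ℝ) = L + (l.drop L).length := by
        rw [List.length_drop, Nat.cast_sub hlen.le]; ring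
      calc dist l.formPerm ((l.take L).formPerm * τ) * L
          ≤ (2 / N + dist (l.drop L).formPerm τ) * L := by gcongr
        _ = 2 / N * L + dist (l.drop L).formPerm τ * L := by ring
        _ ≤ 2 / N * L + 2 * (l.drop L).length / N := by gcongr
        _ = 2 * l.length / N := by rw [h2]; ring

/-- The bound is in terms of the support rather than `N` because it must add up over disjoint
cycles. -/
theorem exists_cycleType_le_support {N L : ℕ} (hL : 0 < L) (σ : Perm (Fin N)) :
    ∃ τ : Perm (Fin N), τ.support ⊆ σ.support ∧ (∀ i ∈ τ.cycleType, i ≤ L) ∧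
      dist σ τ * L ≤ 2 * σ.support.card / N := by
  induction σ using cycle_induction_on with
  | base_one => exact ⟨1, by simp⟩
  | base_cycles σ hσ =>
    obtain ⟨x, hx, -⟩ := id hσ
    obtain ⟨τ, h1, h2, h3⟩ := exists_dist_formPerm_le hL (toList σ x) (nodup_toList σ x)
    rw [formPerm_toList, hσ.cycleOf_eq hx, length_toList, hσ.cycleOf_eq hx] at h3
    refine ⟨τ, h1.trans fun a ha => ?_, h2, h3⟩
    rw [List.mem_toFinset, mem_toList_iff] at ha
    rw [← ha.1.mem_support_iff]
    exact ha.2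
  | induction_disjoint σ τ hd _ ihσ ihτ =>
    obtain ⟨σ', h1, h2, h3⟩ := ihσ
    obtain ⟨τ', k1, k2, k3⟩ := ihτ
    have hd' : Disjoint σ' τ' := by
      rw [disjoint_iff_disjoint_support] at hd ⊢
      exact Finset.disjoint_of_subset_left h1 (Finset.disjoint_of_subset_right k1 hd)
    refine ⟨σ' * τ', ?_, ?_, ?_⟩
    · rw [hd.support_mul]
      exact (support_mul_le _ _).trans (Finset.union_subset_union h1 k1)
    · intro i hi
      rw [hd'.cycleType_mul, Multiset.mem_add] at hi
      exact hi.elim (h2 i) (k2 i)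
    · calc dist (σ * τ) (σ' * τ') * L ≤ (dist σ σ' + dist τ τ') * L := by
            gcongr; exact dist_mul_mul_le' _ _ _ _
        _ = dist σ σ' * L + dist τ τ' * L := by ring
        _ ≤ 2 * σ.support.card / N + 2 * τ.support.card / N := by gcongr
        _ = _ := by rw [hd.card_support_mul]; push_cast; ring

theorem exists_cycleType_le {N L : ℕ} (hL : 0 < L) (σ : Perm (Fin N)) :
    ∃ τ : Perm (Fin N), (∀ i ∈ τ.cycleType, i ≤ L) ∧ dist σ τ ≤ 2 / L := by
  obtain ⟨τ, -, h1, h2⟩ := exists_cycleType_le_support hL σ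
  refine ⟨τ, h1, ?_⟩
  rw [le_div_iff₀ (by positivity)]
  refine h2.trans (div_le_of_le_mul₀ (by positivity) (by norm_num) ?_)
  gcongr
  simpa using Finset.card_le_univ σ.support

/-! ### Repeating a permutation -/

theorem cycleType_list_prod {α : Type*} [Fintype α] [DecidableEq α] {l : List (Perm α)}
    (h : l.Pairwise Disjoint) : l.prod.cycleType = (l.map cycleType).sum := by
  induction l with
  | nil => simp
  | cons a l ih =>
    rw [List.pairwise_cons] at h
    rw [List.prod_cons, List.map_cons, List.sum_cons, ← ih h.2,
      (disjoint_prod_right l h.1).cycleType_mul]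

section Repeat

variable {α β : Type*} [Fintype α] [DecidableEq α] [Fintype β] [DecidableEq β]

/-- Acting on one fibre is extending `σ` by the identity along the bijection of `β` with that fibre.
-/
theorem cycleType_prodExtendRight (a : α) (σ : Perm β) :
    (prodExtendRight a σ).cycleType = σ.cycleType := by
  let e : β ≃ {p : α × β // p.1 = a} :=
    { toFun := fun b => ⟨(a, b), rfl⟩
      invFun := fun p => p.1.2
      left_inv := fun _ => rfl
      right_inv := by rintro ⟨⟨_, b⟩, rfl⟩; rfl }
  rw [← cycleType_extendDomain e (g := σ)]
  congr 1
  ext1 ⟨c, b⟩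
  by_cases h : c = a
  · subst h
    rw [prodExtendRight_apply_eq, extendDomain_apply_subtype σ e (b := (c, b)) rfl]
    rfl
  · rw [prodExtendRight_apply_ne _ h, extendDomain_apply_not_subtype σ e (b := (c, b)) h]

theorem cycleType_prodCongrRight (σ : Perm β) :
    cycleType (Equiv.prodCongrRight fun _ : α => σ) = Fintype.card α • σ.cycleType := by
  rw [← prod_prodExtendRight (fun _ : α => σ) (l := Finset.univ.toList) (Finset.nodup_toList _)
    (by simp), cycleType_list_prod]
  · simp [Function.comp_def, cycleType_prodExtendRight]
  · rw [List.pairwise_map]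
    refine (Finset.nodup_toList _).imp fun {a b} hab => ?_
    rintro ⟨c, d⟩
    by_cases h : c = a
    · exact Or.inr (prodExtendRight_apply_ne _ (h ▸ hab) _)
    · exact Or.inl (prodExtendRight_apply_ne _ h _)

end Repeat

/-- `q` disjoint copies of a permutation of `n` points, and fixed points elsewhere. -/
theorem exists_hom_cycleType {n q N : ℕ} (h : q * n ≤ N) :
    ∃ f : Perm (Fin n) →* Perm (Fin N), ∀ σ, (f σ).cycleType = q • σ.cycleType := by
  classical
  let r : Perm (Fin n) →* Perm (Fin q × Fin n) :=
    { toFun := fun σ => Equiv.prodCongrRight fun _ => σ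
      map_one' := rfl
      map_mul' := fun _ _ => rfl }
  let e : Fin q × Fin n ↪ Fin N := finProdFinEquiv.toEmbedding.trans (Fin.castLEEmb h)
  refine ⟨(viaEmbeddingHom e).comp r, fun σ => ?_⟩
  have := cycleType_prodCongrRight (α := Fin q) σ
  rw [Fintype.card_fin] at this
  change (r σ).cycleType = _ at this
  rw [← this, MonoidHom.comp_apply, viaEmbeddingHom_apply, viaEmbedding]
  convert cycleType_extendDomain (Equiv.ofInjective e.1 e.2) (g := r σ)

end Equiv.Perm

/-! ### Division of multisets -/

/-- Divide each multiplicity by `q` with remainder. At most `L + 1` values occur, each at most `L`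
and left over fewer than `q` times. -/
theorem Multiset.exists_eq_nsmul_add (m : Multiset ℕ) {L q : ℕ} (hq : 0 < q)
    (h : ∀ i ∈ m, i ≤ L) :
    ∃ a b : Multiset ℕ, m = q • a + b ∧ b.sum ≤ q * (L + 1) ^ 2 := by
  refine ⟨∑ i ∈ m.toFinset, (m.count i / q) • {i}, ∑ i ∈ m.toFinset, (m.count i % q) • {i},
    ?_, ?_⟩
  · conv_lhs => rw [← Multiset.toFinset_sum_count_nsmul_eq m]
    rw [Finset.smul_sum, ← Finset.sum_add_distrib]
    refine Finset.sum_congr rfl fun i _ => ?_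
    rw [smul_smul, ← add_smul, Nat.div_add_mod]
  · have hsub : m.toFinset ⊆ Finset.range (L + 1) := fun i hi => by
      have := h i (Multiset.mem_toFinset.1 hi)
      simp; omega
    have hsum : (∑ i ∈ m.toFinset, (m.count i % q) • ({i} : Multiset ℕ)).sum =
        ∑ i ∈ m.toFinset, (m.count i % q) * i := by
      rw [← Multiset.coe_sumAddMonoidHom, map_sum]
      simp [Multiset.sum_nsmul]
    calc _ = ∑ i ∈ m.toFinset, (m.count i % q) * i := hsum
      _ ≤ ∑ i ∈ m.toFinset, q * (L + 1) := by
        refine Finset.sum_le_sum fun i hi => Nat.mul_le_mul (Nat.mod_lt _ hq).le ?_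
        have := h i (Multiset.mem_toFinset.1 hi)
        omega
      _ ≤ ∑ i ∈ Finset.range (L + 1), q * (L + 1) := Finset.sum_le_sum_of_subset hsub
      _ = q * (L + 1) ^ 2 := by simp; ring

/-! ### Approximating a permutation by copies of a smaller one. -/

namespace Equiv.Perm

/-- A permutation with prescribed cycle type outside the support of a given permutation. -/
theorem exists_disjoint_cycleType {α : Type*} [Fintype α] [DecidableEq α] (w : Perm α)
    (m : Multiset ℕ) (h2 : ∀ i ∈ m, 2 ≤ i) (hm : w.cycleType.sum + m.sum ≤ Fintype.card α) :
    ∃ z : Perm α, Disjoint w z ∧ z.cycleType = m := by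
  obtain ⟨z, hz⟩ := (exists_with_cycleType_iff {a : α // a ∉ w.support} (m := m)).2 ⟨by
    rw [Fintype.card_subtype_compl, Fintype.card_coe, ← sum_cycleType]
    omega, h2⟩
  refine ⟨ofSubtype z, fun a => ?_, by rw [cycleType_ofSubtype, hz]⟩
  by_cases ha : a ∈ w.support
  · exact Or.inr (ofSubtype_apply_of_not_mem z (by simpa using ha))
  · exact Or.inl (notMem_support.1 ha)

/-- For large `n`, and for `N` large compared to `n`, every permutation of `N` points is up to a
small error a multiple of a permutation of `n` points. -/
theorem exists_hom_dist_le {δ : ℝ} (hδ : 0 < δ) : ∃ n₀ : ℕ, ∀ n ≥ n₀, ∀ᶠ N : ℕ in atTop,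
    ∀ σ : Perm (Fin N), ∃ (τ : Perm (Fin n)) (f : Perm (Fin n) →* Perm (Fin N)),
      (∀ a b, |dist (f a) (f b) - dist a b| ≤ δ) ∧ dist σ (f τ) ≤ δ := by
  -- Half of `δ` pays for cutting the cycles (`2 / L`), the other half for the undivided cycles (`(L
  -- + 1) ^ 2 / n`).
  obtain ⟨L, hL⟩ := exists_nat_gt (4 / δ)
  have hL0 : (0 : ℝ) < L := lt_trans (by positivity) hL
  obtain ⟨n₀, hn₀⟩ := exists_nat_gt (2 * ((L : ℝ) + 1) ^ 2 / δ)
  have hn₀0 : (0 : ℝ) < n₀ := lt_trans (by positivity) hn₀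
  refine ⟨n₀, fun n hn => ?_⟩
  have hn' : (n₀ : ℝ) ≤ n := by exact_mod_cast hn
  have hnR : (0 : ℝ) < n := hn₀0.trans_le hn'
  have hnpos : 0 < n := by exact_mod_cast hnR
  obtain ⟨N₀, hN₀⟩ := exists_nat_gt ((n : ℝ) / δ)
  -- `N ≥ n * n` gives `n ≤ q`, needed to fit `τ` into `n` points; `N > n / δ` makes the `N % n`
  -- uncovered points negligible.
  filter_upwards [eventually_ge_atTop (n * n), eventually_ge_atTop N₀] with N hN1 hN2 σ
  have hN2' : (n : ℝ) / δ < N := hN₀.trans_le (by exact_mod_cast hN2)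
  have hNR : (0 : ℝ) < N := lt_trans (by positivity) hN2'
  set q := N / n with hq
  have hqn : n ≤ q := (Nat.le_div_iff_mul_le hnpos).2 hN1
  have hq0 : 0 < q := by omega
  have hdm : n * q + N % n = N := Nat.div_add_mod N n
  have hmod : N % n < n := Nat.mod_lt _ hnpos
  have hqnN : q * n ≤ N := Nat.div_mul_le_self N n
  obtain ⟨ρ, hρ, hσρ⟩ := exists_cycleType_le (by exact_mod_cast hL0 : 0 < L) σ
  obtain ⟨m, b, hmb, hb⟩ := ρ.cycleType.exists_eq_nsmul_add hq0 hρ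
  have hsum : q * m.sum + b.sum ≤ N := by
    have := sum_cycleType_le ρ
    rwa [hmb, Multiset.sum_add, Multiset.sum_nsmul, smul_eq_mul, Fintype.card_fin] at this
  have hm2 : ∀ i ∈ m, 2 ≤ i := fun i hi => two_le_of_mem_cycleType (σ := ρ) (by
    rw [hmb, Multiset.mem_add, Multiset.mem_nsmul_of_ne_zero hq0.ne']; exact Or.inl hi)
  have hb2 : ∀ i ∈ b, 2 ≤ i := fun i hi => two_le_of_mem_cycleType (σ := ρ) (by
    rw [hmb, Multiset.mem_add]; exact Or.inr hi)
  obtain ⟨τ, hτ⟩ := (exists_with_cycleType_iff (Fin n) (m := m)).2 ⟨by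
    rw [Fintype.card_fin]
    -- Otherwise `q * (n + 1) ≤ N = n * q + N % n`, contradicting `N % n < n ≤ q`.
    by_contra! hlt
    have : q * (n + 1) ≤ q * m.sum := Nat.mul_le_mul_left q hlt
    rw [mul_add, mul_comm q n] at this
    omega, hm2⟩
  obtain ⟨f, hf⟩ := exists_hom_cycleType hqnN
  -- Adding the leftover cycles beside `f τ` gives exactly the cycle type of `ρ`, hence a conjugate
  -- of `ρ`.
  obtain ⟨z, hz, hzb⟩ := exists_disjoint_cycleType (f τ) b hb2 (by
    rw [hf, hτ, Multiset.sum_nsmul, smul_eq_mul, Fintype.card_fin]; exact hsum)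
  have hconj : IsConj (f τ * z) ρ := isConj_of_cycleType_eq (by
    rw [hz.cycleType_mul, hf, hτ, hzb, hmb])
  obtain ⟨c, hc⟩ := isConj_iff.1 hconj
  refine ⟨τ, (MulAut.conj c).toMonoidHom.comp f, fun x y => ?_, ?_⟩
  · have h1 : dist (c * f x * c⁻¹) (c * f y * c⁻¹) = dist x y * (q * n / N) := by
      rw [dist_mul_right', dist_mul_left', dist_eq_sum_cycleType, dist_eq_sum_cycleType,
        ← map_inv, ← map_mul, hf, Multiset.sum_nsmul]
      push_cast [smul_eq_mul]
      field_simp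
    have h2 : |dist x y * (q * n / N) - dist x y| = dist x y * ((N % n : ℕ) / N) := by
      have h3 : ((n * q + N % n : ℕ) : ℝ) = N := by rw [hdm]
      push_cast at h3
      have h4 : dist x y * (q * n / N) - dist x y = -(dist x y * ((N % n : ℕ) / N)) := by
        field_simp
        linear_combination dist x y * h3
      rw [h4, abs_neg, abs_of_nonneg (by positivity)]
    change |dist (c * f x * c⁻¹) (c * f y * c⁻¹) - dist x y| ≤ δ
    rw [h1, h2]
    calc dist x y * ((N % n : ℕ) / N) ≤ 1 * ((n : ℝ) / N) := by
          gcongr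
          exact dist_le_one' _ _
      _ ≤ δ := by
          rw [one_mul, div_le_iff₀ hNR]
          rw [div_lt_iff₀ hδ] at hN2'
          linarith
  · have h1 : dist ρ (c * f τ * c⁻¹) ≤ ((L : ℝ) + 1) ^ 2 / n := by
      rw [← hc, dist_mul_right', dist_mul_left']
      -- After conjugation the distance is that of `f τ * z` from `f τ`, so only the points moved by
      -- `z` count.
      nth_rewrite 2 [← mul_one (f τ)]
      rw [dist_mul_left', dist_one_eq_sum_cycleType, hzb, div_le_div_iff₀ hNR hnR]
      have h2 : (b.sum : ℝ) ≤ q * ((L : ℝ) + 1) ^ 2 := by exact_mod_cast hb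
      have h3 : (q : ℝ) * n ≤ N := by exact_mod_cast hqnN
      calc (b.sum : ℝ) * n ≤ q * ((L : ℝ) + 1) ^ 2 * n := by gcongr
        _ = ((L : ℝ) + 1) ^ 2 * (q * n) := by ring
        _ ≤ _ := by gcongr
    have h2 : ((L : ℝ) + 1) ^ 2 / n ≤ δ / 2 := by
      rw [div_lt_iff₀ hδ] at hn₀
      rw [div_le_iff₀ hnR]
      nlinarith
    have h3 : (2 : ℝ) / L ≤ δ / 2 := by
      rw [div_lt_iff₀ hδ] at hL
      rw [div_le_iff₀ hL0]
      linarith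
    calc dist σ (c * f τ * c⁻¹) ≤ dist σ ρ + dist ρ (c * f τ * c⁻¹) := dist_triangle _ _ _
      _ ≤ δ := by linarith

end Equiv.Perm

/-! ### Suprema and infima in the unit interval against real bounds. -/

theorem unitInterval.coe_iSup_le {ι : Type*} {f : ι → unitInterval} {c : ℝ} (hc : 0 ≤ c)
    (h : ∀ i, (f i : ℝ) ≤ c) : ((⨆ i, f i : unitInterval) : ℝ) ≤ c := by
  have : (⨆ i, f i) ≤ (⟨min c 1, le_min hc zero_le_one, min_le_right _ _⟩ : unitInterval) :=
    iSup_le fun i => Subtype.coe_le_coe.1 (le_min (h i) (unitInterval.le_one _))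
  exact (Subtype.coe_le_coe.2 this).trans (min_le_left _ _)

theorem unitInterval.le_coe_iInf {ι : Type*} {f : ι → unitInterval} {c : ℝ} (hc : c ≤ 1)
    (h : ∀ i, c ≤ f i) : c ≤ (⨅ i, f i : unitInterval) := by
  have : (⟨max c 0, le_max_right _ _, max_le hc zero_le_one⟩ : unitInterval) ≤ ⨅ i, f i :=
    le_iInf fun i => Subtype.coe_le_coe.1 (max_le (h i) (unitInterval.nonneg _))
  exact (le_max_left _ _).trans (Subtype.coe_le_coe.2 this)

/-! ### Convergence -/

/-- The number of occurrences of variables in a term. -/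
def GroupTerm.size {n : ℕ} : GroupTerm n → ℕ
  | .var _ => 1
  | .one => 0
  | .mul s t => s.size + t.size
  | .inv t => t.size

section Transfer

variable {G H : Type*} [Group G] [Group H]

theorem GroupTerm.map_eval (f : G →* H) {n : ℕ} (v : Fin n → G) (t : GroupTerm n) :
    f (t.eval v) = t.eval fun i => f (v i) := by
  induction t with
  | var i => rfl
  | one => exact map_one f
  | mul s t hs ht => simp [eval, hs, ht]
  | inv t ht => simp [eval, ht]

variable [MetricSpace G] [MetricSpace H]

theorem GroupTerm.dist_eval_le [IsBiinvariantMetricGroup G] {n : ℕ} {v w : Fin n → G} {δ : ℝ}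
    (h : ∀ i, dist (v i) (w i) ≤ δ) (t : GroupTerm n) :
    dist (t.eval v) (t.eval w) ≤ t.size * δ := by
  induction t with
  | var i => simpa [eval, size] using h i
  | one => simp [eval, size]
  | mul s t hs ht =>
    refine (dist_mul_mul_le' _ _ _ _).trans ((add_le_add hs ht).trans_eq ?_)
    simp only [size]; push_cast; ring
  | inv t ht => simpa only [eval, size, dist_inv_inv'] using ht

/-- `v` and `w` correspond to each other up to `δ` under an almost isometric homomorphism. -/
structure IsAlmostEmbedded (δ : ℝ) (f : G →* H) {n : ℕ} (v : Fin n → G) (w : Fin n → H) :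
    Prop where
  abs_dist_sub_le : ∀ a b, |dist (f a) (f b) - dist a b| ≤ δ
  dist_le : ∀ i, dist (w i) (f (v i)) ≤ δ

theorem IsAlmostEmbedded.mono {δ δ' : ℝ} {f : G →* H} {n : ℕ} {v : Fin n → G} {w : Fin n → H}
    (h : IsAlmostEmbedded δ f v w) (hδ : δ ≤ δ') : IsAlmostEmbedded δ' f v w :=
  ⟨fun a b => (h.1 a b).trans hδ, fun i => (h.2 i).trans hδ⟩

theorem IsAlmostEmbedded.snoc {δ : ℝ} {f : G →* H} {n : ℕ} {v : Fin n → G} {w : Fin n → H}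
    (h : IsAlmostEmbedded δ f v w) (hδ : 0 ≤ δ) (a : G) :
    IsAlmostEmbedded δ f (Fin.snoc v a : Fin (n + 1) → G) (Fin.snoc w (f a) : Fin (n + 1) → H) :=
  ⟨h.1, fun i => by
    induction i using Fin.lastCases with
    | last => simpa using hδ
    | cast i => simpa using h.2 i⟩

/-- Each occurrence of a variable costs `δ` when `w` is replaced by `f ∘ v`; the extra `1` is the
distortion of `f`, applied once because `f` commutes with terms. -/
theorem IsAlmostEmbedded.abs_dist_eval_sub_le [IsBiinvariantMetricGroup H] {δ : ℝ} {f : G →* H}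
    {n : ℕ} {v : Fin n → G} {w : Fin n → H} (h : IsAlmostEmbedded δ f v w) (s t : GroupTerm n) :
    |dist (s.eval w) (t.eval w) - dist (s.eval v) (t.eval v)| ≤ (s.size + t.size + 1) * δ := by
  have hs := GroupTerm.dist_eval_le h.2 s
  have ht := GroupTerm.dist_eval_le h.2 t
  rw [← GroupTerm.map_eval] at hs ht
  have h1 := h.1 (s.eval v) (t.eval v)
  have h2 : |dist (s.eval w) (t.eval w) - dist (f (s.eval v)) (f (t.eval v))| ≤
      dist (s.eval w) (f (s.eval v)) + dist (t.eval w) (f (t.eval v)) := by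
    simpa [Real.dist_eq] using
      dist_dist_dist_le (s.eval w) (t.eval w) (f (s.eval v)) (f (t.eval v))
  calc _ ≤ |dist (s.eval w) (t.eval w) - dist (f (s.eval v)) (f (t.eval v))| +
        |dist (f (s.eval v)) (f (t.eval v)) - dist (s.eval v) (t.eval v)| := abs_sub_le _ _ _
    _ ≤ _ := by linarith

end Transfer

/-! ### Transfer of formulas along almost embeddings. -/

namespace MetricFormula

/-- Connectives are uniformly continuous on compact cubes, so `δ` can be chosen independently of the
groups. -/
theorem IsQuantifierFree.exists_dist_eval_le {n : ℕ} {ψ : MetricFormula n}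
    (hψ : ψ.IsQuantifierFree) {ε : ℝ} (hε : 0 < ε) :
    ∃ δ > 0, ∀ (G H : Type) [Group G] [Group H] [MetricSpace G] [MetricSpace H]
      [IsBiinvariantMetricGroup G] [IsBiinvariantMetricGroup H] (f : G →* H)
      (v : Fin n → G) (w : Fin n → H), IsAlmostEmbedded δ f v w →
      Dist.dist (ψ.eval w) (ψ.eval v) ≤ ε := by
  induction ψ generalizing ε with
  | dist s t =>
    refine ⟨ε / (s.size + t.size + 1), by positivity, ?_⟩
    intro G H _ _ _ _ _ _ f v w h
    refine (h.abs_dist_eval_sub_le s t).trans_eq ?_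
    field_simp
  | @conn n k u φ ih =>
    obtain ⟨η, hη, hu⟩ := Metric.uniformContinuous_iff.1
      (CompactSpace.uniformContinuous_of_continuous u.continuous) ε hε
    choose δ hδ h using fun i => ih i (hψ i) (half_pos hη)
    obtain ⟨δ', hδ', hle⟩ : ∃ δ' > 0, ∀ i, δ' ≤ δ i := by
      rcases isEmpty_or_nonempty (Fin k) with _ | _
      · exact ⟨1, one_pos, isEmptyElim⟩
      · obtain ⟨i, hi⟩ := Finite.exists_min δ
        exact ⟨δ i, hδ i, hi⟩
    refine ⟨δ', hδ', ?_⟩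
    intro G H _ _ _ _ _ _ f v w hvw
    refine (hu ?_).le
    refine ((dist_pi_le_iff (half_pos hη).le).2 fun i => ?_).trans_lt (half_lt_self hη)
    exact h i G H f v w (hvw.mono (hle i))
  | sup φ => exact hψ.elim
  | inf φ => exact hψ.elim

/-- A witness `a` in `G` is matched by `f a` in `H`. Elements of `H` need not come from `G`, so the
inequality goes one way only. -/
theorem eval_sups_le {G H : Type*} [Group G] [Group H] [MetricSpace G] [MetricSpace H]
    [IsBiinvariantMetricGroup G] [IsBiinvariantMetricGroup H] (f : G →* H) {δ ε : ℝ} (hδ : 0 ≤ δ)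
    (hε : 0 ≤ ε)     {k n : ℕ} (φ : MetricFormula (k + n))
    (hφ : ∀ (v : Fin (k + n) → G) (w : Fin (k + n) → H), IsAlmostEmbedded δ f v w →
      (φ.eval v : ℝ) ≤ φ.eval w + ε)
    {v : Fin k → G} {w : Fin k → H} (h : IsAlmostEmbedded δ f v w) :
    ((sups n φ).eval v : ℝ) ≤ (sups n φ).eval w + ε := by
  induction n with
  | zero => exact hφ v w h
  | succ n ih =>
    refine ih (.sup φ) fun v w hvw => unitInterval.coe_iSup_le ?_ fun a =>
      (hφ _ _ (hvw.snoc hδ a)).trans (add_le_add_left (Subtype.coe_le_coe.2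
        (le_iSup (fun b : H => φ.eval (Fin.snoc w b : Fin (k + n + 1) → H)) (f a))) ε)
    exact add_nonneg (unitInterval.nonneg _) hε

theorem IsSigmaTwo.eventually_value_le {φ : MetricFormula 0} (hφ : φ.IsSigmaTwo) {ε : ℝ}
    (hε : 0 < ε) : ∃ n₀ : ℕ, ∀ n ≥ n₀, ∀ᶠ N : ℕ in atTop,
      (φ.value (Equiv.Perm (Fin n)) : ℝ) ≤ φ.value (Equiv.Perm (Fin N)) + ε := by
  obtain ⟨k, ψ, hψ, rfl⟩ := hφ
  obtain ⟨δ, hδ, h⟩ := hψ.exists_dist_eval_le hε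
  obtain ⟨n₀, hn₀⟩ := Equiv.Perm.exists_hom_dist_le hδ
  refine ⟨n₀, fun n hn => ?_⟩
  filter_upwards [hn₀ n hn] with N hN
  rw [← sub_le_iff_le_add]
  refine unitInterval.le_coe_iInf ((sub_le_self _ hε.le).trans (unitInterval.le_one _)) fun σ => ?_
  obtain ⟨τ, f, hf, hστ⟩ := hN σ
  rw [sub_le_iff_le_add]
  refine (Subtype.coe_le_coe.2 (iInf_le _ τ)).trans
    (eval_sups_le f hδ.le hε.le ψ (fun v w hvw => ?_) ⟨hf, fun i => ?_⟩)
  · have := (abs_le.1 (h _ _ f v w hvw)).1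
    change -ε ≤ (ψ.eval w : ℝ) - ψ.eval v at this
    linarith
  · induction i using Fin.lastCases with
    | last => simpa only [Fin.snoc_last] using hστ
    | cast i => exact i.elim0

end MetricFormula

/-- A bounded sequence converges if its terms are almost bounded by all much later terms. -/
theorem exists_tendsto_of_eventually_le_add {a : ℕ → unitInterval}
    (h : ∀ ε > 0, ∃ n₀ : ℕ, ∀ n ≥ n₀, ∀ᶠ N in atTop, (a n : ℝ) ≤ a N + ε) :
    ∃ L, Tendsto a atTop (𝓝 L) := by
  refine ⟨liminf a atTop, tendsto_of_le_liminf_of_limsup_le le_rfl ?_⟩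
  rw [← Subtype.coe_le_coe]
  refine le_of_forall_pos_le_add fun ε hε => ?_
  obtain ⟨n₀, hn₀⟩ := h ε hε
  -- The bounds `liminf + ε` and `a n - ε` are compared inside `[0,1]`; where they leave it, the
  -- claim is trivial.
  by_cases h1 : 1 ≤ ((liminf a atTop : unitInterval) : ℝ) + ε
  · exact (unitInterval.le_one _).trans h1
  push Not at h1
  have h0 : 0 ≤ ((liminf a atTop : unitInterval) : ℝ) + ε := add_nonneg (unitInterval.nonneg _) hε.le
  have key : limsup a atTop ≤
      (⟨((liminf a atTop : unitInterval) : ℝ) + ε, h0, h1.le⟩ : unitInterval) := by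
    refine limsup_le_of_le (by isBoundedDefault) ?_
    filter_upwards [eventually_ge_atTop n₀] with n hn
    rw [← Subtype.coe_le_coe]
    change (a n : ℝ) ≤ ((liminf a atTop : unitInterval) : ℝ) + ε
    rw [← sub_le_iff_le_add]
    by_cases h2 : (a n : ℝ) - ε ≤ 0
    · exact h2.trans (unitInterval.nonneg _)
    push Not at h2
    refine Subtype.coe_le_coe.2 (?_ : (⟨(a n : ℝ) - ε, h2.le,
      (sub_le_self _ hε.le).trans (unitInterval.le_one _)⟩ : unitInterval) ≤ liminf a atTop)
    refine le_liminf_of_le (by isBoundedDefault) ?_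
    filter_upwards [hn₀ n hn] with N hN
    rw [← Subtype.coe_le_coe]
    exact sub_le_iff_le_add.2 hN
  exact key

/-! ### Metric ultraproducts -/

namespace MetricFormula

section Los

variable {ι : Type*} (U : Ultrafilter ι) (G : ι → Type*) [∀ i, Group (G i)]
  [∀ i, MetricSpace (G i)] [∀ i, IsBiinvariantMetricGroup (G i)]

/-- The class of a sequence in the metric ultraproduct. -/
def ultraMk (f : ∀ i, G i) : MetricUltraproduct U G :=
  SeparationQuotient.mk (f : PreUltraproduct U G)

variable {G}

theorem eval_ultraMk {n : ℕ} (v : Fin n → ∀ i, G i) (t : GroupTerm n) :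
    t.eval (fun j => ultraMk U G (v j)) = ultraMk U G fun i => t.eval fun j => v j i := by
  induction t with
  | var i => rfl
  | one => rfl
  | mul s t hs ht => rw [GroupTerm.eval, hs, ht]; rfl
  | inv t ht => rw [GroupTerm.eval, ht]; rfl

/-- The value of a formula in a metric ultraproduct is the limit of its values. -/
theorem tendsto_eval_ultraproduct {n : ℕ} (φ : MetricFormula n) (v : Fin n → ∀ i, G i) :
    Tendsto (fun i => φ.eval fun j => v j i) U (𝓝 (φ.eval fun j => ultraMk U G (v j))) := by
  have hsnoc : ∀ {n : ℕ} (v : Fin n → ∀ i, G i) (a : ∀ i, G i) (i : ι),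
      (fun j => (Fin.snoc v a : Fin (n + 1) → ∀ i, G i) j i) = Fin.snoc (fun j => v j i) (a i) := by
    intro n v a i
    ext j
    induction j using Fin.lastCases <;> simp
  have hsnoc' : ∀ {n : ℕ} (v : Fin n → ∀ i, G i) (a : ∀ i, G i),
      (fun j => ultraMk U G ((Fin.snoc v a : Fin (n + 1) → ∀ i, G i) j)) =
        Fin.snoc (fun j => ultraMk U G (v j)) (ultraMk U G a) := by
    intro n v a
    ext j
    induction j using Fin.lastCases <;> simp
  induction φ with
  | dist s t =>
    rw [tendsto_subtype_rng]
    have h := tendsto_ultraDist U (fun i => s.eval fun j => v j i) (fun i => t.eval fun j => v j i)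
    change Tendsto _ _ (𝓝 (Dist.dist (s.eval fun j => ultraMk U G (v j))
      (t.eval fun j => ultraMk U G (v j))))
    rw [eval_ultraMk, eval_ultraMk]
    exact h
  | conn u φ ih => exact (u.continuous.tendsto _).comp (tendsto_pi_nhds.2 fun k => ih k v)
  | sup φ ih =>
    have ih' := fun a : ∀ i, G i => ih (Fin.snoc v a)
    simp only [hsnoc, hsnoc'] at ih'
    refine tendsto_order.2 ⟨fun c hc => ?_, fun c hc => ?_⟩
    · obtain ⟨a, ha⟩ := lt_iSup_iff.1 (hc : c < ⨆ a, _)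
      obtain ⟨a, rfl⟩ := SeparationQuotient.surjective_mk a
      filter_upwards [(ih' a).eventually_const_lt ha] with i hi
      exact hi.trans_le (le_iSup (fun b : G i => φ.eval (Fin.snoc (fun j => v j i) b)) (a i))
    · obtain ⟨d, hd, hdc⟩ := exists_between hc
      -- Choose witnesses wherever the supremum exceeds `d`, with `1` as default. Their class in the
      -- ultraproduct has value below `d`, so `U`-almost everywhere the supremum is below `c`.
      have hex : ∀ i, ∃ a : G i, d < (MetricFormula.sup φ).eval (fun j => v j i) →
          d < φ.eval (Fin.snoc (fun j => v j i) a) := fun i => by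
        by_cases h : d < (MetricFormula.sup φ).eval (fun j => v j i)
        · obtain ⟨a, ha⟩ := lt_iSup_iff.1 (h : d < ⨆ a, _)
          exact ⟨a, fun _ => ha⟩
        · exact ⟨1, fun h' => absurd h' h⟩
      choose a ha using hex
      have hle := le_iSup (fun b => φ.eval (Fin.snoc (fun j => ultraMk U G (v j)) b)) (ultraMk U G a)
      filter_upwards [(ih' a).eventually_lt_const (hle.trans_lt hd)] with i hi
      by_contra hcon
      exact lt_asymm hi (ha i (hdc.trans_le (not_lt.1 hcon)))
  | inf φ ih =>
    have ih' := fun a : ∀ i, G i => ih (Fin.snoc v a)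
    simp only [hsnoc, hsnoc'] at ih'
    refine tendsto_order.2 ⟨fun c hc => ?_, fun c hc => ?_⟩
    · obtain ⟨d, hcd, hd⟩ := exists_between hc
      have hex : ∀ i, ∃ a : G i, (MetricFormula.inf φ).eval (fun j => v j i) < d →
          φ.eval (Fin.snoc (fun j => v j i) a) < d := fun i => by
        by_cases h : (MetricFormula.inf φ).eval (fun j => v j i) < d
        · obtain ⟨a, ha⟩ := iInf_lt_iff.1 (h : ⨅ a, _ < d)
          exact ⟨a, fun _ => ha⟩
        · exact ⟨1, fun h' => absurd h' h⟩
      choose a ha using hex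
      have hle := iInf_le (fun b => φ.eval (Fin.snoc (fun j => ultraMk U G (v j)) b)) (ultraMk U G a)
      filter_upwards [(ih' a).eventually_const_lt (hd.trans_le hle)] with i hi
      by_contra hcon
      exact lt_asymm hi (ha i ((not_lt.1 hcon).trans_lt hcd))
    · obtain ⟨a, ha⟩ := iInf_lt_iff.1 (hc : ⨅ a, _ < c)
      obtain ⟨a, rfl⟩ := SeparationQuotient.surjective_mk a
      filter_upwards [(ih' a).eventually_lt_const ha] with i hi
      exact (iInf_le (fun b : G i => φ.eval (Fin.snoc (fun j => v j i) b)) (a i)).trans_lt hi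

variable (G) in
theorem tendsto_value_ultraproduct (φ : MetricFormula 0) :
    Tendsto (fun i => φ.value (G i)) U (𝓝 (φ.value (MetricUltraproduct U G))) := by
  have h := φ.tendsto_eval_ultraproduct U (Fin.elim0 : Fin 0 → ∀ i, G i)
  convert h using 2
  · exact congrArg φ.eval (Subsingleton.elim _ _)
  · exact congrArg φ.eval (Subsingleton.elim _ _)

end Los

/-! ### Negation -/

section Negation

variable {G : Type*} [Group G] [MetricSpace G] [IsBiinvariantMetricGroup G]

theorem eval_sup_of_eval_eq_symm {n : ℕ} {φ φ' : MetricFormula (n + 1)}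
    (h : ∀ v : Fin (n + 1) → G, φ'.eval v = unitInterval.symm (φ.eval v)) (v : Fin n → G) :
    (MetricFormula.sup φ').eval v = unitInterval.symm ((MetricFormula.inf φ).eval v) := by
  refine le_antisymm (iSup_le fun a => ?_) ?_
  · rw [h, unitInterval.symm_le_symm]
    exact iInf_le _ a
  · rw [unitInterval.symm_le_comm]
    refine le_iInf fun a => ?_
    rw [unitInterval.symm_le_comm, ← h]
    exact le_iSup (fun a : G => φ'.eval (Fin.snoc v a : Fin (n + 1) → G)) a

theorem eval_sups_of_eval_eq_symm {k : ℕ} (n : ℕ) {φ φ' : MetricFormula (k + n)}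
    (h : ∀ v : Fin (k + n) → G, φ'.eval v = unitInterval.symm (φ.eval v)) (v : Fin k → G) :
    (sups n φ').eval v = unitInterval.symm ((infs n φ).eval v) := by
  induction n with
  | zero => exact h v
  | succ n ih => exact ih (eval_sup_of_eval_eq_symm h)

theorem eval_inf_of_eval_eq_symm {n : ℕ} {φ φ' : MetricFormula (n + 1)}
    (h : ∀ v : Fin (n + 1) → G, φ'.eval v = unitInterval.symm (φ.eval v)) (v : Fin n → G) :
    (MetricFormula.inf φ').eval v = unitInterval.symm ((MetricFormula.sup φ).eval v) := by
  rw [eval_sup_of_eval_eq_symm (φ := φ') (φ' := φ) (fun v => by rw [h, unitInterval.symm_symm]),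
    unitInterval.symm_symm]

end Negation

/-- The negation of a `Π₂` sentence is equivalent to a `Σ₂` sentence. -/
theorem IsPiTwo.exists_isSigmaTwo {φ : MetricFormula 0} (hφ : φ.IsPiTwo) :
    ∃ φ' : MetricFormula 0, φ'.IsSigmaTwo ∧ ∀ (G : Type) [Group G] [MetricSpace G]
      [IsBiinvariantMetricGroup G], φ'.value G = unitInterval.symm (φ.value G) := by
  obtain ⟨n, ψ, hψ, rfl⟩ := hφ
  let neg : C(Fin 1 → unitInterval, unitInterval) :=
    ⟨fun x => unitInterval.symm (x 0), unitInterval.continuous_symm.comp (continuous_apply 0)⟩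
  refine ⟨.inf (sups n (.conn neg fun _ => ψ)),
    ⟨n, .conn neg fun _ => ψ, fun _ : Fin 1 => hψ, rfl⟩, fun G _ _ _ => ?_⟩
  exact eval_inf_of_eval_eq_symm (eval_sups_of_eval_eq_symm n fun v => rfl) _

theorem IsSigmaTwo.exists_tendsto_value {φ : MetricFormula 0} (hφ : φ.IsSigmaTwo) :
    ∃ L : unitInterval, Tendsto (fun n : ℕ => φ.value (Equiv.Perm (Fin n))) atTop (𝓝 L) :=
  exists_tendsto_of_eventually_le_add fun _ hε => hφ.eventually_value_le hε

theorem IsSigmaTwo.value_universalSoficGroup_eq {φ : MetricFormula 0} (hφ : φ.IsSigmaTwo)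
    {U V : Ultrafilter ℕ} (hU : (U : Filter ℕ) ≤ cofinite) (hV : (V : Filter ℕ) ≤ cofinite) :
    φ.value (UniversalSoficGroup U) = φ.value (UniversalSoficGroup V) := by
  obtain ⟨L, hL⟩ := hφ.exists_tendsto_value
  -- A nonprincipal ultrafilter refines `atTop`, so the limit along it is `L`.
  have key : ∀ W : Ultrafilter ℕ, (W : Filter ℕ) ≤ cofinite → φ.value (UniversalSoficGroup W) = L :=
    fun W hW => tendsto_nhds_unique
      (φ.tendsto_value_ultraproduct W fun n => Equiv.Perm (Fin n))
      (hL.mono_left (Nat.cofinite_eq_atTop ▸ hW))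
  rw [key U hU, key V hV]

end MetricFormula

end

theorem mainTheorem5 :
    (∀ φ : MetricFormula 0, φ.IsSigmaTwo →
      ∃ L : unitInterval,
        Tendsto (fun n : ℕ => φ.value (Equiv.Perm (Fin n))) atTop (𝓝 L)) ∧
    (∀ U V : Ultrafilter ℕ, (U : Filter ℕ) ≤ cofinite → (V : Filter ℕ) ≤ cofinite →
      (∀ φ : MetricFormula 0, φ.IsSigmaTwo →
        φ.value (UniversalSoficGroup U) = φ.value (UniversalSoficGroup V)) ∧
      (∀ φ : MetricFormula 0, φ.IsPiTwo →
        φ.value (UniversalSoficGroup U) = φ.value (UniversalSoficGroup V))) := by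
  refine ⟨fun φ hφ => hφ.exists_tendsto_value, fun U V hU hV =>
    ⟨fun φ hφ => hφ.value_universalSoficGroup_eq hU hV, fun φ hφ => ?_⟩⟩
  obtain ⟨φ', hφ', h⟩ := hφ.exists_isSigmaTwo
  refine unitInterval.symm_bijective.injective ?_
  rw [← h, ← h, hφ'.value_universalSoficGroup_eq hU hV]
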